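/- Let $n\ge 1$ and $0<r<\frac1{2n}$, and let $Q_n=\mathbb{T}^2\setminus\bigcup_{i=0}^{n-1}D_i$, where $\mathbb{T}^2=\mathbb{R}^2/\mathbb{Z}^2$ and $D_i$ is the open disk of radius $r$ centered at $(i/n,0)$ modulo $\mathbb{Z}^2$. Consider the billiard flow on $Q_n$ (uniform motion with unit speed, specular reflection at the boundary). Let $a,b_1,\dots,b_n$ be the standard free generators of $\pi_1(Q_n)\cong F_{n+1}$ with base point $(\frac12,\frac12)$: $a$ is the class of the loop that crosses the wall $\{0\}\times[r,1-r]$ once in the positive direction and crosses no other wall, and $b_i$ is the class of the loop that crosses the wall $[\frac{i-1}{n}+r,\frac in-r]\times\{0\}$ once in the positive direction and crosses no other wall (walls are taken modulo $\mathbb{Z}^2$). Let $\mathrm{dist}$ be the distance in the Cayley graph of $\pi_1(Q_n)$ with respect to these generators. For a trajectory segment $\{x(t)\mid 0\le t\le T\}$, let $g_T\in\pi_1(Q_n)$ be the class of the loop obtained by joining both ends of the segment to the base point inside the unit cells $[k,k+1)\times[l,l+1)$ containing (lifts of) them. Let $C=\bigl([0,\infty)\times\mathrm{Ends}(\pi_1(Q_n))\bigr)/\bigl(\{0\}\times\mathrm{Ends}(\pi_1(Q_n))\bigr)$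 be the cone over the space of ends of the Cayley graph, let $B(0,\rho)=\{(s,e)\in C\mid s\le\rho\}$, and let the homotopical rotation set $R\subset C$ consist of all points $(s,e)$ for which there are trajectory segments of lengths $T_j\to\infty$ whose associated group elements $g_j$ satisfy $\frac1{T_j}\mathrm{dist}(g_j,1)\to s$ and, if $s>0$, converge to the end $e$. Theorem 2.1. For all $n\ge1$ and $0<r<\frac1{2n}$, $$R\subset B(0,2\sqrt2).$$ Moreover, there is an absolute constant $K$ such that for all such $n$ and $r$, and for every trajectory segment of length $T\ge0$ of the billiard flow on $Q_n$, the element $g_T\in\pi_1(Q_n)$ is represented by a reduced word in $a^{\pm1},b_1^{\pm1},\dots,b_n^{\pm1}$ of length at most $2\sqrt2\,T+K$. -/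

import Mathlib

open Filter Topology

noncomputable section

/-- The Euclidean plane. -/
abbrev Plane := EuclideanSpace ℝ (Fin 2)

/-- The flat torus `ℝ² / ℤ²`. -/
abbrev Torus := AddCircle (1 : ℝ) × AddCircle (1 : ℝ)

/-- The covering projection `ℝ² → ℝ² / ℤ²`. -/
def Plane.toTorus (p : Plane) : Torus := ((p 0 : AddCircle (1 : ℝ)), (p 1 : AddCircle (1 : ℝ)))

theorem coe_eq_coe_of_sub_eq_int {x y : ℝ} {k : ℤ} (h : x - y = k) :
    (x : AddCircle (1 : ℝ)) = y := by
  rw [← sub_eq_zero, ← AddCircle.coe_sub, AddCircle.coe_eq_zero_iff]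
  exact ⟨k, by simp [h]⟩

theorem exists_int_of_coe_eq_coe {x y : ℝ} (h : (x : AddCircle (1 : ℝ)) = y) :
    ∃ k : ℤ, x - y = k := by
  rw [← sub_eq_zero, ← AddCircle.coe_sub, AddCircle.coe_eq_zero_iff] at h
  obtain ⟨k, hk⟩ := h
  exact ⟨k, by simpa using hk.symm⟩

/-- The parameters of the billiard: the number `n ≥ 1` of scatterers and their radius `r > 0`,
small enough for the `n` closed disks to be pairwise disjoint in the torus. -/
structure BilliardTable where
  n : ℕ
  r : ℝ
  n_pos : 0 < n
  r_pos : 0 < r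
  r_lt : r < 1 / (2 * n)

namespace BilliardTable

variable (B : BilliardTable)

/-- The centres `(k / n, l)`, `k, l ∈ ℤ`, of the scatterers lifted to the plane. -/
def center (k l : ℤ) : Plane := !₂[(k : ℝ) / B.n, (l : ℝ)]

/-- The open disk `D_i` in the torus, of radius `r` and centre `(i / n, 0)` modulo `ℤ²`. -/
def disk (i : Fin B.n) : Set Torus :=
  Plane.toTorus '' Metric.ball (B.center (i : ℤ) 0) B.r

/-- The configuration space `Q_n`: the torus minus the disks `D_0, …, D_{n-1}`. -/
def table : Set Torus := (⋃ i : Fin B.n, B.disk i)ᶜ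

/-- The configuration space lifted to the plane. -/
def liftedTable : Set Plane := {p | ∀ k l : ℤ, B.r ≤ dist p (B.center k l)}

theorem dist_center (p : Plane) (k l : ℤ) :
    dist p (B.center k l) = Real.sqrt ((p 0 - k / B.n) ^ 2 + (p 1 - l) ^ 2) := by
  simp [EuclideanSpace.dist_eq, Fin.sum_univ_two, center, Real.dist_eq, sq_abs]

theorem toTorus_mem_table_iff (p : Plane) : p.toTorus ∈ B.table ↔ p ∈ B.liftedTable := by
  have hn : (B.n : ℝ) ≠ 0 := by exact_mod_cast B.n_pos.ne'
  have hn' : (B.n : ℤ) ≠ 0 := by exact_mod_cast B.n_pos.ne'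
  simp only [table, disk, liftedTable, Set.mem_compl_iff, Set.mem_iUnion, Set.mem_image,
    Metric.mem_ball, Set.mem_ofPred_eq, not_exists, not_and]
  constructor
  · intro h k l
    by_contra! hlt
    have hk : 0 ≤ k % B.n := Int.emod_nonneg _ hn'
    have hk2 : k % B.n < B.n := Int.emod_lt_of_pos _ (by exact_mod_cast B.n_pos)
    have hnat : ((k % B.n).toNat : ℤ) = k % B.n := Int.toNat_of_nonneg hk
    have hdiv : (k : ℝ) = B.n * ((k / B.n : ℤ) : ℝ) + ((k % B.n : ℤ) : ℝ) := by
      exact_mod_cast (Int.mul_ediv_add_emod k B.n).symm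
    refine h ⟨(k % B.n).toNat, by omega⟩ !₂[p 0 - ((k / B.n : ℤ) : ℝ), p 1 - (l : ℝ)] ?_ ?_
    · refine lt_of_eq_of_lt ?_ hlt
      simp only [dist_center, hnat, hdiv, Matrix.cons_val_zero,
        Matrix.cons_val_one]
      congr 2
      · field_simp
        ring
      · simp
    · simp only [Plane.toTorus, Matrix.cons_val_zero, Matrix.cons_val_one,
        Prod.mk.injEq]
      constructor
      · exact coe_eq_coe_of_sub_eq_int (k := -(k / B.n)) (by push_cast; ring)
      · exact coe_eq_coe_of_sub_eq_int (k := -l) (by push_cast; ring)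
  · intro h i q hq heq
    simp only [Plane.toTorus, Prod.mk.injEq] at heq
    obtain ⟨h0, h1⟩ := heq
    obtain ⟨a, ha⟩ := exists_int_of_coe_eq_coe h0.symm
    obtain ⟨b, hb⟩ := exists_int_of_coe_eq_coe h1.symm
    refine absurd (h (i + B.n * a) b) (not_le.2 ?_)
    refine lt_of_eq_of_lt ?_ hq
    have ha : p 0 = q 0 + a := by linarith
    have hb : p 1 = q 1 + b := by linarith
    simp only [dist_center, ha, hb]
    congr 2
    · push_cast
      field_simp
      ring
    · simp

theorem mem_liftedTable_iff (p : Plane) :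
    p ∈ B.liftedTable ↔ ∀ k l : ℤ, B.r ^ 2 ≤ (p 0 - k / B.n) ^ 2 + (p 1 - l) ^ 2 := by
  refine forall_congr' fun k => forall_congr' fun l => ?_
  rw [dist_center, Real.le_sqrt' B.r_pos]

/-- The projection of the lifted configuration space onto `Q_n`. -/
def proj (p : B.liftedTable) : B.table :=
  ⟨p.1.toTorus, (B.toTorus_mem_table_iff p.1).2 p.2⟩

theorem continuous_proj : Continuous B.proj := by
  refine Continuous.subtype_mk (Continuous.prodMk ?_ ?_) _
  · exact (AddCircle.continuous_mk' (1 : ℝ)).comp (by fun_prop)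
  · exact (AddCircle.continuous_mk' (1 : ℝ)).comp (by fun_prop)

/-! ### Straight paths in the lifted configuration space -/

/-- The straight path between two points of the plane, as a path in the lifted configuration
space. -/
def linePath {p q : Plane} (h : segment ℝ p q ⊆ B.liftedTable) :
    Path (⟨p, h (left_mem_segment ℝ p q)⟩ : B.liftedTable)
      ⟨q, h (right_mem_segment ℝ p q)⟩ where
  toFun t := ⟨AffineMap.lineMap p q (t : ℝ), h (by
    rw [segment_eq_image_lineMap]
    exact ⟨t, t.2, rfl⟩)⟩
  continuous_toFun := by
    refine Continuous.subtype_mk ?_ _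
    exact (AffineMap.lineMap_continuous).comp continuous_subtype_val
  source' := by simp
  target' := by simp

theorem r_lt_half : B.r < 1 / 2 := by
  refine B.r_lt.trans_le ?_
  have : (1 : ℝ) ≤ B.n := by exact_mod_cast B.n_pos
  rw [div_le_div_iff₀ (by positivity) (by norm_num)]
  linarith

theorem horizontal_subset (x x' : ℝ) (l : ℤ) :
    segment ℝ (!₂[x, (l : ℝ) + 1 / 2] : Plane) !₂[x', (l : ℝ) + 1 / 2] ⊆ B.liftedTable := by
  rintro p ⟨a, b, -, -, hab, rfl⟩
  rw [mem_liftedTable_iff]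
  intro k m
  have h1 : (a • (!₂[x, (l : ℝ) + 1 / 2] : Plane) + b • (!₂[x', (l : ℝ) + 1 / 2] : Plane)) 1
      = (l : ℝ) + 1 / 2 := by
    simp only [PiLp.add_apply, PiLp.smul_apply, smul_eq_mul,
      Matrix.cons_val_one, Matrix.cons_val_zero]
    rw [← add_mul, hab, one_mul]
  rw [h1]
  have hr := B.r_lt_half
  have hr0 := B.r_pos
  have key : (1 / 2 : ℝ) ^ 2 ≤ ((l : ℝ) + 1 / 2 - m) ^ 2 := by
    rcases le_or_gt m l with hm | hm
    · have : (m : ℝ) ≤ l := by exact_mod_cast hm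
      nlinarith
    · have : (l : ℝ) + 1 ≤ m := by exact_mod_cast hm
      nlinarith
  nlinarith [sq_nonneg ((a • (!₂[x, (l : ℝ) + 1 / 2] : Plane)
    + b • (!₂[x', (l : ℝ) + 1 / 2] : Plane)) 0 - (k : ℝ) / B.n)]

/-- The vertical lines half way between neighbouring scatterers do not meet the scatterers. -/
theorem vertical_subset (i : ℤ) (y y' : ℝ) :
    segment ℝ (!₂[((i : ℝ) + 1 / 2) / B.n, y] : Plane) !₂[((i : ℝ) + 1 / 2) / B.n, y']
      ⊆ B.liftedTable := by
  have hn : (0 : ℝ) < B.n := by exact_mod_cast B.n_pos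
  rintro p ⟨a, b, -, -, hab, rfl⟩
  rw [mem_liftedTable_iff]
  intro k m
  have h0 : (a • (!₂[((i : ℝ) + 1 / 2) / B.n, y] : Plane)
      + b • (!₂[((i : ℝ) + 1 / 2) / B.n, y'] : Plane)) 0 = ((i : ℝ) + 1 / 2) / B.n := by
    simp only [PiLp.add_apply, PiLp.smul_apply, smul_eq_mul,
      Matrix.cons_val_zero]
    rw [← add_mul, hab, one_mul]
  rw [h0]
  have hr := B.r_lt
  have hr0 := B.r_pos
  have key : (1 / (2 * B.n) : ℝ) ^ 2 ≤ (((i : ℝ) + 1 / 2) / B.n - k / B.n) ^ 2 := by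
    rw [← sub_div, div_pow, div_pow, mul_pow,
      div_le_div_iff₀ (by positivity) (by positivity)]
    have : (1 / 2 : ℝ) ^ 2 ≤ ((i : ℝ) + 1 / 2 - k) ^ 2 := by
      rcases le_or_gt k i with hm | hm
      · have : (k : ℝ) ≤ i := by exact_mod_cast hm
        nlinarith
      · have : (i : ℝ) + 1 ≤ k := by exact_mod_cast hm
        nlinarith
    nlinarith [sq_pos_of_pos hn]
  nlinarith [sq_nonneg ((a • (!₂[((i : ℝ) + 1 / 2) / B.n, y] : Plane)
    + b • (!₂[((i : ℝ) + 1 / 2) / B.n, y'] : Plane)) 1 - (m : ℝ))]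

/-- The vertical segment joining a point of the lifted configuration space to the horizontal
midline of its unit cell does not meet the scatterers. -/
theorem drop_subset (p : B.liftedTable) :
    segment ℝ (!₂[p.1 0, (⌊p.1 1⌋ : ℝ) + 1 / 2] : Plane) p.1 ⊆ B.liftedTable := by
  obtain ⟨p, hp⟩ := p
  rw [mem_liftedTable_iff] at hp
  rintro q ⟨a, b, ha, hb, hab, rfl⟩
  rw [mem_liftedTable_iff]
  intro k m
  have h0 : (a • (!₂[p 0, (⌊p 1⌋ : ℝ) + 1 / 2] : Plane) + b • p) 0 = p 0 := by
    simp only [PiLp.add_apply, PiLp.smul_apply, smul_eq_mul,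
      Matrix.cons_val_zero]
    rw [← add_mul, hab, one_mul]
  have h1 : (a • (!₂[p 0, (⌊p 1⌋ : ℝ) + 1 / 2] : Plane) + b • p) 1
      = a * ((⌊p 1⌋ : ℝ) + 1 / 2) + b * p 1 := by
    simp only [PiLp.add_apply, PiLp.smul_apply, smul_eq_mul,
      Matrix.cons_val_one, Matrix.cons_val_zero]
  rw [h0, h1]
  have hr := B.r_lt_half
  have hr0 := B.r_pos
  have hpk := hp k m
  have hf1 := Int.floor_le (p 1)
  have hf2 := Int.lt_floor_add_one (p 1)
  generalize (⌊p 1⌋ : ℤ) = l at *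
  generalize p 1 = y at *
  obtain rfl : a = 1 - b := by linarith
  have key : (1 / 2 : ℝ) ^ 2 ≤ ((1 - b) * ((l : ℝ) + 1 / 2) + b * y - m) ^ 2 ∨
      (y - m) ^ 2 ≤ ((1 - b) * ((l : ℝ) + 1 / 2) + b * y - m) ^ 2 := by
    rcases le_or_gt m l with hm | hm
    · have hm' : (m : ℝ) ≤ l := by exact_mod_cast hm
      rcases le_total y (l + 1 / 2) with hy | hy
      · right
        apply pow_le_pow_left₀ (by linarith)
        nlinarith
      · left
        apply pow_le_pow_left₀ (by norm_num)
        nlinarith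
    · have hm' : (l : ℝ) + 1 ≤ m := by exact_mod_cast hm
      rw [← neg_sq ((1 - b) * ((l : ℝ) + 1 / 2) + b * y - m), ← neg_sq (y - m)]
      rcases le_total y (l + 1 / 2) with hy | hy
      · left
        apply pow_le_pow_left₀ (by norm_num)
        nlinarith
      · right
        apply pow_le_pow_left₀ (by linarith)
        nlinarith
  rcases key with key | key
  · nlinarith [sq_nonneg (p 0 - (k : ℝ) / B.n)]
  · linarith

/-! ### The fundamental group and its generators -/

/-- The centre `(k + 1/2, l + 1/2)` of a unit cell, as a point of the lifted configuration
space. -/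
def cellCenter (k l : ℤ) : B.liftedTable :=
  ⟨!₂[(k : ℝ) + 1 / 2, (l : ℝ) + 1 / 2],
    B.horizontal_subset _ ((k : ℝ) + 1 / 2) l (left_mem_segment ℝ _ _)⟩

/-- The base point `(1/2, 1/2)` of `Q_n`. -/
def base : B.table := B.proj (B.cellCenter 0 0)

theorem proj_cellCenter (k l : ℤ) : B.proj (B.cellCenter k l) = B.base := by
  apply Subtype.ext
  simp only [base, proj, cellCenter, Plane.toTorus, Matrix.cons_val_zero,
    Matrix.cons_val_one, Prod.mk.injEq]
  constructor
  · exact coe_eq_coe_of_sub_eq_int (k := k) (by push_cast; ring)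
  · exact coe_eq_coe_of_sub_eq_int (k := l) (by push_cast; ring)

/-- The fundamental group `π₁(Q_n)`. Mathlib's product `p * q` of two loops runs through `q`
first; passing to the opposite group makes `g * h` the concatenation "first `g`, then `h`". -/
abbrev Pi1 := (FundamentalGroup B.table B.base)ᵐᵒᵖ

/-- The element of `π₁(Q_n)` represented by a loop. -/
def loopClass (c : Path B.base B.base) : B.Pi1 :=
  MulOpposite.op (FundamentalGroup.fromPath (Path.Homotopic.Quotient.mk c))

/-- The loop `a`: it runs straight from `(1/2, 1/2)` to `(3/2, 1/2)`, crossing the wall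
`{0} × [r, 1 - r]` (modulo `ℤ²`) once, in the positive direction, and no other wall. -/
def loopA : Path B.base B.base :=
  ((B.linePath (B.horizontal_subset ((0 : ℤ) + 1 / 2) ((1 : ℤ) + 1 / 2) 0)).map
    B.continuous_proj).cast rfl (B.proj_cellCenter 1 0).symm

/-- The loop `b_{i+1}`, `0 ≤ i < n`: inside the unit cell it goes horizontally from `(1/2, 1/2)`
to `((i + 1/2) / n, 1/2)`, then straight up to `((i + 1/2) / n, 3/2)`, crossing the wall
`[i / n + r, (i + 1) / n - r] × {0}` (modulo `ℤ²`) once, in the positive direction, and then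
horizontally, inside the next cell, to `(1/2, 3/2)`. -/
def loopB (i : Fin B.n) : Path B.base B.base :=
  ((((B.linePath (B.horizontal_subset ((0 : ℤ) + 1 / 2) (((i : ℤ) + 1 / 2) / B.n) 0)).trans
      (B.linePath (B.vertical_subset i ((0 : ℤ) + 1 / 2) ((1 : ℤ) + 1 / 2)))).trans
      (B.linePath (B.horizontal_subset (((i : ℤ) + 1 / 2) / B.n) ((0 : ℤ) + 1 / 2) 1))).map
    B.continuous_proj).cast rfl (B.proj_cellCenter 0 1).symm

/-- The `n + 1` generators `a, b_1, …, b_n` of `π₁(Q_n)`: `none` stands for `a` and `some i` for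
`b_{i+1}`. -/
def generator : Option (Fin B.n) → B.Pi1
  | none => B.loopClass B.loopA
  | some i => B.loopClass (B.loopB i)

/-- The element of `π₁(Q_n)` spelled by a (reduced) word in the letters `a, b_1, …, b_n` and
their inverses. -/
def evalWord : FreeGroup (Option (Fin B.n)) →* B.Pi1 := FreeGroup.lift B.generator

/-- The Cayley graph of `π₁(Q_n)` with respect to `a, b_1, …, b_n`; the edges join `g` to
`g s` for the generators `s`. -/
def cayleyGraph : SimpleGraph B.Pi1 := SimpleGraph.mulCayley (Set.range B.generator)

/-- `Ends(π₁(Q_n))`: the ends of the Cayley graph. -/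
abbrev Ends := B.cayleyGraph.end

/-- A sequence of group elements converges to an end: for every finite set `K` of vertices of
the Cayley graph it is eventually in the component of the complement of `K` that the end
selects. -/
def ConvergesToEnd (g : ℕ → B.Pi1) (e : B.Ends) : Prop :=
  ∀ K : Finset B.Pi1, ∀ᶠ j in atTop,
    g j ∈ SimpleGraph.ComponentCompl.supp (G := B.cayleyGraph) (K := (K : Set B.Pi1))
      (e.1 (Opposite.op K))

/-! ### Billiard trajectories -/

/-- A (complete) trajectory of the billiard flow, lifted to the plane, with its velocities just
before and just after each instant. The point moves uniformly with unit speed between collisions,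
never enters a scatterer, and is reflected specularly at the boundaries of the scatterers:
`v⁺ = v⁻ - 2 ⟪v⁻, ν⟫ ν` with `ν = (x - c) / r` the unit normal. In a tangential collision this
says `v⁺ = v⁻`. -/
structure Trajectory where
  pos : ℝ → Plane
  velBefore : ℝ → Plane
  velAfter : ℝ → Plane
  pos_mem : ∀ t, pos t ∈ B.liftedTable
  unit_speed : ∀ t, ‖velAfter t‖ = 1
  motion_after : ∀ t, ∀ᶠ s in 𝓝[>] t, pos s = pos t + (s - t) • velAfter t
  motion_before : ∀ t, ∀ᶠ s in 𝓝[<] t, pos s = pos t + (s - t) • velBefore t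
  free : ∀ t, (∀ k l : ℤ, dist (pos t) (B.center k l) ≠ B.r) → velAfter t = velBefore t
  reflection : ∀ t, ∀ k l : ℤ, dist (pos t) (B.center k l) = B.r →
    velAfter t = velBefore t
      - (2 * inner ℝ (velBefore t) ((1 / B.r) • (pos t - B.center k l))) •
        ((1 / B.r) • (pos t - B.center k l))

variable {B}

theorem Trajectory.continuous_pos (x : B.Trajectory) : Continuous x.pos := by
  rw [continuous_iff_continuousAt]
  intro t
  rw [continuousAt_iff_continuous_left'_right']
  constructor
  · have h : ContinuousWithinAt (fun s => x.pos t + (s - t) • x.velBefore t) (Set.Iio t) t :=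
      Continuous.continuousWithinAt (by fun_prop)
    exact h.congr_of_eventuallyEq (x.motion_before t) (by simp)
  · have h : ContinuousWithinAt (fun s => x.pos t + (s - t) • x.velAfter t) (Set.Ioi t) t :=
      Continuous.continuousWithinAt (by fun_prop)
    exact h.congr_of_eventuallyEq (x.motion_after t) (by simp)

/-- The position at time `t`, as a point of the lifted configuration space. -/
def Trajectory.point (x : B.Trajectory) (t : ℝ) : B.liftedTable := ⟨x.pos t, x.pos_mem t⟩

/-- The trajectory segment `{x(t) | 0 ≤ t ≤ T}`, parametrized by the unit interval. -/
def Trajectory.segmentPath (x : B.Trajectory) (T : ℝ) : Path (x.point 0) (x.point T) where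
  toFun s := x.point (s * T)
  continuous_toFun := by
    refine Continuous.subtype_mk (x.continuous_pos.comp ?_) _
    fun_prop
  source' := by simp
  target' := by simp

variable (B)

/-- The path in `Q_n` from the base point to the projection of a point `p = (x, y)` of the
lifted configuration space which stays in the unit cell of `p`: from the centre of the cell
horizontally to the vertical line through `p`, and then vertically to `p`. -/
def connector (p : B.liftedTable) : Path B.base (B.proj p) :=
  (((B.linePath (B.horizontal_subset ((⌊p.1 0⌋ : ℝ) + 1 / 2) (p.1 0) ⌊p.1 1⌋)).trans
      (B.linePath (B.drop_subset p))).map B.continuous_proj).cast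
    (B.proj_cellCenter ⌊p.1 0⌋ ⌊p.1 1⌋).symm rfl

variable {B}

/-- The element `g_T ∈ π₁(Q_n)` of a trajectory segment `{x(t) | 0 ≤ t ≤ T}`: the segment is
closed up to a loop at the base point by joining its two ends to the base point within their
unit cells. -/
def Trajectory.homotopyClass (x : B.Trajectory) (T : ℝ) : B.Pi1 :=
  B.loopClass (((B.connector (x.point 0)).trans
    ((x.segmentPath T).map B.continuous_proj)).trans (B.connector (x.point T)).symm)

end BilliardTable

/-! ### The cone over the ends and the rotation set -/

/-- The identification of all pairs `(0, e)`. -/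
def coneSetoid (E : Type*) : Setoid (NNReal × E) where
  r p q := p = q ∨ (p.1 = 0 ∧ q.1 = 0)
  iseqv :=
    { refl := fun _ => Or.inl rfl
      symm := by
        rintro p q (rfl | ⟨h, h'⟩)
        · exact Or.inl rfl
        · exact Or.inr ⟨h', h⟩
      trans := by
        rintro p q s (rfl | ⟨h, h'⟩) (rfl | ⟨k, k'⟩)
        · exact Or.inl rfl
        · exact Or.inr ⟨k, k'⟩
        · exact Or.inr ⟨h, h'⟩
        · exact Or.inr ⟨h, k'⟩ }

/-- The infinite cone `([0, ∞) × E) / ({0} × E)`. -/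
def InfiniteCone (E : Type*) := Quotient (coneSetoid E)

namespace InfiniteCone

variable {E : Type*}

/-- The point `(s, e)` of the cone. -/
def mk (s : NNReal) (e : E) : InfiniteCone E := Quotient.mk (coneSetoid E) (s, e)

/-- The distance `s` of the point `(s, e)` from the vertex `0` of the cone. -/
def radius : InfiniteCone E → NNReal :=
  Quotient.lift Prod.fst (by
    rintro p q (rfl | ⟨h, h'⟩)
    · rfl
    · rw [h, h'])

/-- The ball `B(0, ρ)` about the vertex of the cone: the points `(s, e)` with `s ≤ ρ`. -/
def ball (ρ : ℝ) : Set (InfiniteCone E) := {c | (radius c : ℝ) ≤ ρ}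

end InfiniteCone

/-- The homotopical rotation set `R`: the points `(s, e)` of the cone over `Ends(π₁(Q_n))` for
which there are trajectory segments of lengths `T_j → ∞` whose elements `g_j` of `π₁(Q_n)` have
average speed `dist(g_j, 1) / T_j → s` and escape in the direction `e`. (At the vertex `s = 0` of
the cone there is no direction.) -/
def BilliardTable.rotationSet (B : BilliardTable) : Set (InfiniteCone B.Ends) :=
  {c | ∃ (s : NNReal) (e : B.Ends), c = InfiniteCone.mk s e ∧
    ∃ (x : ℕ → B.Trajectory) (T : ℕ → ℝ), Tendsto T atTop atTop ∧
      Tendsto (fun j => (B.cayleyGraph.dist ((x j).homotopyClass (T j)) 1 : ℝ) / T j)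
        atTop (𝓝 (s : ℝ)) ∧
      (s ≠ 0 → B.ConvergesToEnd (fun j => (x j).homotopyClass (T j)) e)}

end

/-! The word of a trajectory segment is read off from the lines `y = l`, `l ∈ ℤ`, alone. They cut
the lifted table into strips `l ≤ y ≤ l + 1`. A strip retracts vertically to its midline, so it is
contractible, and a path within it represents the power of `a` whose exponent is the difference of
the integer parts of the horizontal coordinates of its ends, however often it crosses the vertical
walls (`liftClass_stripClass`). Changing to the neighbouring strip at a point of the line between
them costs one letter `b_i^{±1}` (`liftClass_stripClass_crossing`). If the trajectory crosses the
lines at the times `t_1 < … < t_N`, then its element of `π₁(Q_n)` is therefore a product of `N`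
letters `b_i^{±1}` and `N + 1` powers of `a` with exponents of absolute value at most `|Δx| + 1`,
where `Δx` is the horizontal displacement during the respective passage.

It remains to compare `|Δx| + 2` with the duration `Δt` of a passage through a strip. If the passage
ends on the other boundary line of the strip, then `Δx² + 1 ≤ Δt²` because the speed is `1`. The
trajectory can also come back to the line that it started from. The scatterers on that line only
push it further away, so it has to reach a scatterer on the opposite line, hence a height of at
least `1 - r > 1 / 2` (`Trajectory.exists_half_le_of_return`). Minkowski's inequality for the way
there and the way back gives `Δx² + 1 ≤ Δt²` again (`Trajectory.passage_length`). By the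
Cauchy-Schwarz inequality `|Δx| + 2 ≤ √5 Δt ≤ 2√2 Δt`. The segments before the first and after the
last crossing contribute the additive constant.

The bound on the rotation set follows, because the distance from `g` to `1` in the Cayley graph is
at most the length of any word for `g`. -/

noncomputable section

theorem Path.Homotopic.of_mem_of_simplyConnectedSpace {X : Type*} [TopologicalSpace X]
    {U : Set X} [SimplyConnectedSpace U] {p q : X} (γ γ' : Path p q)
    (h : ∀ t, γ t ∈ U) (h' : ∀ t, γ' t ∈ U) : γ.Homotopic γ' := by
  have hp : p ∈ U := by simpa using h 0
  have hq : q ∈ U := by simpa using h 1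
  let δ : Path (⟨p, hp⟩ : U) ⟨q, hq⟩ :=
    { toFun := fun t => ⟨γ t, h t⟩
      continuous_toFun := γ.continuous.subtype_mk _
      source' := by simp
      target' := by simp }
  let δ' : Path (⟨p, hp⟩ : U) ⟨q, hq⟩ :=
    { toFun := fun t => ⟨γ' t, h' t⟩
      continuous_toFun := γ'.continuous.subtype_mk _
      source' := by simp
      target' := by simp }
  exact (SimplyConnectedSpace.paths_homotopic δ δ').map ⟨Subtype.val, continuous_subtype_val⟩

namespace BilliardTable

variable (B : BilliardTable)

/-! ### Classes of lifted paths between cell centres -/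

/-- The covering projection as a bundled continuous map. -/
def projMap : C(B.liftedTable, B.table) := ⟨B.proj, B.continuous_proj⟩

/-- The element of `π₁(Q_n)` represented by the projection of a homotopy class of paths in the
lifted configuration space, both of whose ends lie over the base point. -/
def liftClass {p q : B.liftedTable} (γ : Path.Homotopic.Quotient p q)
    (hp : B.proj p = B.base) (hq : B.proj q = B.base) : B.Pi1 :=
  MulOpposite.op (FundamentalGroup.fromPath ((γ.map B.projMap).cast hp.symm hq.symm))

variable {B}

theorem liftClass_mk {p q : B.liftedTable} (γ : Path p q)
    (hp : B.proj p = B.base) (hq : B.proj q = B.base) :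
    B.liftClass (Path.Homotopic.Quotient.mk γ) hp hq
      = B.loopClass ((γ.map B.continuous_proj).cast hp.symm hq.symm) := rfl

theorem loopClass_trans (c d : Path B.base B.base) :
    B.loopClass (c.trans d) = B.loopClass c * B.loopClass d := rfl

theorem loopClass_refl : B.loopClass (Path.refl B.base) = 1 := rfl

theorem liftClass_trans {p q s : B.liftedTable} (γ : Path.Homotopic.Quotient p q)
    (δ : Path.Homotopic.Quotient q s) (hp : B.proj p = B.base) (hq : B.proj q = B.base)
    (hs : B.proj s = B.base) :
    B.liftClass (γ.trans δ) hp hs = B.liftClass γ hp hq * B.liftClass δ hq hs := by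
  induction γ with | mk γ =>
  induction δ with | mk δ =>
  rw [← Path.Homotopic.Quotient.mk_trans, liftClass_mk, liftClass_mk, liftClass_mk,
    ← loopClass_trans]
  congr 1
  refine Path.ext (funext fun t => ?_)
  simp [Path.trans_apply]

theorem liftClass_refl {p : B.liftedTable} (hp : B.proj p = B.base) :
    B.liftClass (Path.Homotopic.Quotient.refl p) hp hp = 1 := by
  rw [← Path.Homotopic.Quotient.mk_refl, liftClass_mk, ← loopClass_refl]
  congr 1
  refine Path.ext (funext fun t => ?_)
  simpa using hp

/-- Paths that differ by a deck transformation represent the same element of `π₁(Q_n)`. -/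
theorem liftClass_mk_eq_of_proj_eq {p q p' q' : B.liftedTable} {γ : Path p q} {γ' : Path p' q'}
    (hp : B.proj p = B.base) (hq : B.proj q = B.base)
    (hp' : B.proj p' = B.base) (hq' : B.proj q' = B.base)
    (h : ∀ t, B.proj (γ t) = B.proj (γ' t)) :
    B.liftClass (Path.Homotopic.Quotient.mk γ) hp hq
      = B.liftClass (Path.Homotopic.Quotient.mk γ') hp' hq' := by
  rw [liftClass_mk, liftClass_mk]
  congr 1
  refine Path.ext (funext fun t => ?_)
  simpa using h t

theorem proj_eq_proj {p q : B.liftedTable} (k l : ℤ) (h0 : p.1 0 - q.1 0 = k)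
    (h1 : p.1 1 - q.1 1 = l) : B.proj p = B.proj q := by
  apply Subtype.ext
  exact Prod.ext (coe_eq_coe_of_sub_eq_int h0) (coe_eq_coe_of_sub_eq_int h1)

variable (B)

/-! ### Horizontal strips -/

/-- The horizontal strip `l ≤ y ≤ l + 1` of the lifted configuration space. -/
def strip (l : ℤ) : Set B.liftedTable := {p | (l : ℝ) ≤ p.1 1 ∧ p.1 1 ≤ l + 1}

variable {B}

/-- A point that moves vertically towards the midline of its strip does not meet a scatterer: it
moves away from those on the nearer boundary line, and its distance to the others stays at least
`1 / 2 > r`. -/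
theorem vertical_retract_mem {l : ℤ} {p : B.liftedTable} (hp : p ∈ B.strip l) {b : ℝ}
    (hb : 0 ≤ b) (hb1 : b ≤ 1) :
    (!₂[p.1 0, (1 - b) * ((l : ℝ) + 1 / 2) + b * p.1 1] : Plane) ∈ B.liftedTable := by
  obtain ⟨p, hp'⟩ := p
  obtain ⟨hf1, hf2⟩ := hp
  rw [mem_liftedTable_iff] at hp' ⊢
  intro k m
  simp only [Matrix.cons_val_zero, Matrix.cons_val_one] at hf1 hf2 ⊢
  have hpk := hp' k m
  have hr := B.r_lt_half
  have hr0 := B.r_pos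
  generalize p 1 = y at *
  have key : (1 / 2 : ℝ) ^ 2 ≤ ((1 - b) * ((l : ℝ) + 1 / 2) + b * y - m) ^ 2 ∨
      (y - m) ^ 2 ≤ ((1 - b) * ((l : ℝ) + 1 / 2) + b * y - m) ^ 2 := by
    rcases le_or_gt m l with hm | hm
    · have hm' : (m : ℝ) ≤ l := by exact_mod_cast hm
      rcases le_total y (l + 1 / 2) with hy | hy
      · right
        apply pow_le_pow_left₀ (by linarith)
        nlinarith
      · left
        apply pow_le_pow_left₀ (by norm_num)
        nlinarith
    · have hm' : (l : ℝ) + 1 ≤ m := by exact_mod_cast hm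
      rw [← neg_sq ((1 - b) * ((l : ℝ) + 1 / 2) + b * y - m), ← neg_sq (y - m)]
      rcases le_total y (l + 1 / 2) with hy | hy
      · left
        apply pow_le_pow_left₀ (by norm_num)
        nlinarith
      · right
        apply pow_le_pow_left₀ (by linarith)
        nlinarith
  rcases key with key | key
  · nlinarith [sq_nonneg (p 0 - (k : ℝ) / B.n)]
  · linarith

theorem cellCenter_mem_strip (k l : ℤ) : B.cellCenter k l ∈ B.strip l := by
  constructor <;> simp [cellCenter]
  norm_num

theorem mem_strip_floor (p : B.liftedTable) : p ∈ B.strip ⌊p.1 1⌋ :=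
  ⟨Int.floor_le _, (Int.lt_floor_add_one _).le⟩

theorem midline_mem (x : ℝ) (l : ℤ) : (!₂[x, (l : ℝ) + 1 / 2] : Plane) ∈ B.liftedTable :=
  B.horizontal_subset x x l (left_mem_segment ℝ _ _)

/-- A strip retracts vertically to its midline, so it is contractible. -/
instance (l : ℤ) : ContractibleSpace (B.strip l) := by
  have hmid : ∀ x : ℝ, (⟨!₂[x, (l : ℝ) + 1 / 2], midline_mem x l⟩ : B.liftedTable) ∈ B.strip l :=
    fun x => by constructor <;> simp; norm_num
  let f : C(B.strip l, ℝ) := ⟨fun p => p.1.1 0, by fun_prop⟩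
  let g : C(ℝ, B.strip l) := ⟨fun x => ⟨⟨!₂[x, (l : ℝ) + 1 / 2], midline_mem x l⟩, hmid x⟩, by
    refine Continuous.subtype_mk (Continuous.subtype_mk ?_ _) _
    fun_prop⟩
  refine ContinuousMap.HomotopyEquiv.contractibleSpace (Y := ℝ) ⟨f, g, ⟨?_⟩, ?_⟩
  · refine
      { toFun := fun z => ⟨⟨!₂[z.2.1.1 0, (1 - (z.1 : ℝ)) * ((l : ℝ) + 1 / 2) + z.1 * z.2.1.1 1],
          vertical_retract_mem z.2.2 z.1.2.1 z.1.2.2⟩, ?_⟩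
        continuous_toFun := ?_
        map_zero_left := ?_
        map_one_left := ?_ }
    · obtain ⟨⟨s, hs0, hs1⟩, p, hp0, hp1⟩ := z
      constructor <;> simp <;> nlinarith
    · refine Continuous.subtype_mk (Continuous.subtype_mk ?_ _) _
      fun_prop
    · intro p
      ext i
      fin_cases i <;> simp [f, g]
    · intro p
      ext i
      fin_cases i <;> simp
  · have : f.comp g = ContinuousMap.id ℝ := by
      ext x
      simp [f, g]
    rw [this]

/-- The homotopy class of the paths in a strip that join two given points. -/
def stripClass {l : ℤ} {p q : B.liftedTable} (hp : p ∈ B.strip l) (hq : q ∈ B.strip l) :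
    Path.Homotopic.Quotient p q :=
  (Path.Homotopic.Quotient.mk (PathConnectedSpace.somePath (⟨p, hp⟩ : B.strip l) ⟨q, hq⟩)).map
    ⟨Subtype.val, continuous_subtype_val⟩

theorem mk_eq_stripClass {l : ℤ} {p q : B.liftedTable} (γ : Path p q)
    (h : ∀ t, γ t ∈ B.strip l) (hp : p ∈ B.strip l) (hq : q ∈ B.strip l) :
    Path.Homotopic.Quotient.mk γ = stripClass hp hq := by
  rw [stripClass, ← Path.Homotopic.Quotient.mk_map, Path.Homotopic.Quotient.eq]
  exact Path.Homotopic.of_mem_of_simplyConnectedSpace (U := B.strip l) _ _ h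
    fun t => by simp

theorem stripClass_trans {l : ℤ} {p q s : B.liftedTable} (hp : p ∈ B.strip l)
    (hq : q ∈ B.strip l) (hs : s ∈ B.strip l) :
    (stripClass hp hq).trans (stripClass hq hs) = stripClass hp hs := by
  rw [stripClass, stripClass, ← Path.Homotopic.Quotient.mk_map, ← Path.Homotopic.Quotient.mk_map,
    ← Path.Homotopic.Quotient.mk_trans]
  refine mk_eq_stripClass _ (fun t => ?_) _ _
  rw [Path.trans_apply]
  split_ifs <;> simp

theorem stripClass_self {l : ℤ} {p : B.liftedTable} (hp : p ∈ B.strip l) :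
    stripClass hp hp = Path.Homotopic.Quotient.refl p := by
  rw [← Path.Homotopic.Quotient.mk_refl, mk_eq_stripClass _ (fun t => by simpa using hp)]

theorem stripClass_symm {l : ℤ} {p q : B.liftedTable} (hp : p ∈ B.strip l)
    (hq : q ∈ B.strip l) : (stripClass hp hq).symm = stripClass hq hp := by
  rw [stripClass, ← Path.Homotopic.Quotient.mk_map, ← Path.Homotopic.Quotient.mk_symm]
  exact mk_eq_stripClass _ (fun t => by simp [Path.symm_apply]) _ _

/-! ### Generators as classes of lifted paths -/

theorem linePath_apply_zero {p q : Plane} (h : segment ℝ p q ⊆ B.liftedTable) (t : unitInterval) :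
    (B.linePath h t).1 0 = p 0 + t * (q 0 - p 0) := by
  simp [linePath, AffineMap.lineMap_apply]; ring

theorem linePath_apply_one {p q : Plane} (h : segment ℝ p q ⊆ B.liftedTable) (t : unitInterval) :
    (B.linePath h t).1 1 = p 1 + t * (q 1 - p 1) := by
  simp [linePath, AffineMap.lineMap_apply]; ring

theorem proj_linePath_eq {p q p' q' : Plane} (h : segment ℝ p q ⊆ B.liftedTable)
    (h' : segment ℝ p' q' ⊆ B.liftedTable) (k l : ℤ) (hp0 : p 0 = p' 0 + k) (hp1 : p 1 = p' 1 + l)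
    (hq0 : q 0 = q' 0 + k) (hq1 : q 1 = q' 1 + l) (t : unitInterval) :
    B.proj (B.linePath h t) = B.proj (B.linePath h' t) := by
  refine proj_eq_proj k l ?_ ?_
  · rw [linePath_apply_zero, linePath_apply_zero, hp0, hq0]
    ring
  · rw [linePath_apply_one, linePath_apply_one, hp1, hq1]
    ring

theorem proj_trans_eq {p q s p' q' s' : B.liftedTable} {γ : Path p q} {δ : Path q s}
    {γ' : Path p' q'} {δ' : Path q' s'} (h : ∀ t, B.proj (γ t) = B.proj (γ' t))
    (h' : ∀ t, B.proj (δ t) = B.proj (δ' t)) (t : unitInterval) :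
    B.proj (γ.trans δ t) = B.proj (γ'.trans δ' t) := by
  rw [Path.trans_apply, Path.trans_apply]
  split_ifs
  · exact h _
  · exact h' _

/-- A straight path is the concatenation of its two halves. -/
theorem linePath_eq_trans {p m q : Plane} (h : segment ℝ p q ⊆ B.liftedTable)
    (h1 : segment ℝ p m ⊆ B.liftedTable) (h2 : segment ℝ m q ⊆ B.liftedTable)
    (h0 : m = midpoint ℝ p q) : B.linePath h = (B.linePath h1).trans (B.linePath h2) := by
  subst h0
  refine Path.ext (funext fun t => Subtype.ext ?_)
  rw [Path.trans_apply]
  ext i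
  split_ifs <;> simp [linePath, AffineMap.lineMap_apply, midpoint_eq_smul_add] <;> ring

theorem linePath_mem_strip {p q : Plane} (h : segment ℝ p q ⊆ B.liftedTable) {l : ℤ}
    (hp : (l : ℝ) ≤ p 1 ∧ p 1 ≤ l + 1) (hq : (l : ℝ) ≤ q 1 ∧ q 1 ≤ l + 1) (t : unitInterval) :
    B.linePath h t ∈ B.strip l := by
  obtain ⟨s, hs0, hs1⟩ := t
  obtain ⟨hp0, hp1⟩ := hp
  obtain ⟨hq0, hq1⟩ := hq
  constructor <;> rw [linePath_apply_one] <;> dsimp only <;> nlinarith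

theorem liftClass_stripClass_succ (k l : ℤ) :
    B.liftClass (stripClass (B.cellCenter_mem_strip k l) (B.cellCenter_mem_strip (k + 1) l))
      (B.proj_cellCenter _ _) (B.proj_cellCenter _ _) = B.generator none := by
  have h := mk_eq_stripClass
    (B.linePath (B.horizontal_subset ((k : ℤ) + 1 / 2) ((k + 1 : ℤ) + 1 / 2) l))
    (linePath_mem_strip (l := l) _ (by constructor <;> simp; norm_num)
      (by constructor <;> simp; norm_num))
    (B.cellCenter_mem_strip k l) (B.cellCenter_mem_strip (k + 1) l)
  refine (congrArg (fun γ => B.liftClass γ (B.proj_cellCenter _ _) (B.proj_cellCenter _ _))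
    h.symm).trans ?_
  change _ = B.liftClass (Path.Homotopic.Quotient.mk
    (B.linePath (B.horizontal_subset ((0 : ℤ) + 1 / 2) ((1 : ℤ) + 1 / 2) 0)))
      (B.proj_cellCenter 0 0) (B.proj_cellCenter 1 0)
  exact liftClass_mk_eq_of_proj_eq _ _ _ _ fun t =>
    proj_linePath_eq _ _ k l (by simp; ring) (by simp; ring) (by simp; ring) (by simp; ring) t

/-- A path in a strip from the cell `k` to the cell `k'` represents a power of `a`. -/
theorem liftClass_stripClass (k k' l : ℤ) :
    B.liftClass (stripClass (B.cellCenter_mem_strip k l) (B.cellCenter_mem_strip k' l))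
      (B.proj_cellCenter _ _) (B.proj_cellCenter _ _) = B.generator none ^ (k' - k) := by
  induction k' using Int.inductionOn' (b := k) with
  | zero => simp [stripClass_self, liftClass_refl]
  | succ m hm ih =>
    rw [← stripClass_trans _ (B.cellCenter_mem_strip m l),
      liftClass_trans _ _ _ (B.proj_cellCenter _ _), ih, liftClass_stripClass_succ, ← zpow_add_one]
    congr 1
    ring
  | pred m hm ih =>
    generalize hj : m - 1 = j
    obtain rfl : m = j + 1 := by omega
    rw [← stripClass_trans _ (B.cellCenter_mem_strip j l),
      liftClass_trans _ _ _ (B.proj_cellCenter _ _), liftClass_stripClass_succ] at ih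
    rw [eq_mul_inv_of_mul_eq ih, ← zpow_sub_one]
    congr 1
    ring

/-- The vertical band between two neighbouring columns of scatterers is contained in the lifted
table. -/
theorem mem_liftedTable_of_mem_band {q : Plane} {j : ℤ} (h1 : j / B.n + B.r ≤ q 0)
    (h2 : q 0 ≤ (j + 1) / B.n - B.r) : q ∈ B.liftedTable := by
  have hn : (0 : ℝ) < B.n := by exact_mod_cast B.n_pos
  rw [mem_liftedTable_iff]
  intro k m
  suffices B.r ^ 2 ≤ (q 0 - k / B.n) ^ 2 by nlinarith [sq_nonneg (q 1 - m)]
  have hr0 := B.r_pos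
  rcases le_or_gt k j with h | h
  · have : (k : ℝ) / B.n ≤ j / B.n := by gcongr
    nlinarith
  · have : ((j : ℝ) + 1) / B.n ≤ k / B.n := by
      gcongr
      exact_mod_cast h
    nlinarith

/-- A point of the table on a line `y = m` of scatterers lies on a wall. -/
theorem mem_band_of_floor {q : Plane} (hq : q ∈ B.liftedTable) {j m : ℤ} (hm : q 1 = m)
    (hj : ⌊B.n * q 0⌋ = j) : j / B.n + B.r ≤ q 0 ∧ q 0 ≤ (j + 1) / B.n - B.r := by
  have hn : (0 : ℝ) < B.n := by exact_mod_cast B.n_pos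
  rw [mem_liftedTable_iff] at hq
  rw [Int.floor_eq_iff] at hj
  have h1 := hq j m
  have h2 := hq (j + 1) m
  have h3 : (j : ℝ) / B.n ≤ q 0 := by
    rw [div_le_iff₀ hn]; linarith
  have h4 : q 0 < ((j : ℝ) + 1) / B.n := by
    rw [lt_div_iff₀ hn]; linarith
  push_cast at h2
  rw [hm, sub_self] at h1 h2
  constructor
  · have := (pow_le_pow_iff_left₀ B.r_pos.le (sub_nonneg.2 h3) two_ne_zero).1 (by linarith)
    linarith
  · have := (pow_le_pow_iff_left₀ B.r_pos.le (sub_nonneg.2 h4.le) two_ne_zero).1 (by linarith)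
    linarith

/-- The class of the path from the cell `(k, l)` to the cell above it which crosses the line
`y = l + 1` at `p`, between the scatterers `j` and `j + 1` with `j = i + n k`, is the generator
`b_{i+1}`. -/
theorem liftClass_stripClass_crossing (k l : ℤ) (i : Fin B.n) {p : B.liftedTable}
    (hp : p ∈ B.strip l) (hp' : p ∈ B.strip (l + 1)) (hx : ⌊B.n * p.1 0⌋ = i + B.n * k) :
    B.liftClass ((stripClass (B.cellCenter_mem_strip k l) hp).trans
      (stripClass hp' (B.cellCenter_mem_strip k (l + 1))))
      (B.proj_cellCenter _ _) (B.proj_cellCenter _ _) = B.generator (some i) := by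
  have hn : (0 : ℝ) < B.n := by exact_mod_cast B.n_pos
  have hy : p.1 1 = ((l + 1 : ℤ) : ℝ) := by
    have h1 := hp.2
    have h2 := hp'.1
    push_cast at h2 ⊢
    linarith
  have hband := mem_band_of_floor p.2 hy hx
  set j : ℤ := i + B.n * k with hj
  let w : ℝ := ((j : ℝ) + 1 / 2) / B.n
  let M : Plane := !₂[w, ((l + 1 : ℤ) : ℝ)]
  have hM0 : M 0 = w := rfl
  have hM1 : M 1 = ((l + 1 : ℤ) : ℝ) := rfl
  have hseg : segment ℝ p.1 M ⊆ B.liftedTable := by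
    have hw1 : (j : ℝ) / B.n + B.r ≤ w := by
      have := B.r_lt
      have : w = (j : ℝ) / B.n + 1 / (2 * B.n) := by simp only [w]; field_simp
      linarith
    have hw2 : w ≤ ((j : ℝ) + 1) / B.n - B.r := by
      have := B.r_lt
      have : w = ((j : ℝ) + 1) / B.n - 1 / (2 * B.n) := by simp only [w]; field_simp; ring
      linarith
    rintro q ⟨a, b, ha, hb, hab, rfl⟩
    have h0 : (a • p.1 + b • M) 0 = a * p.1 0 + b * w := by simp [hM0]
    obtain rfl : a = 1 - b := by linarith
    refine mem_liftedTable_of_mem_band (j := j) ?_ ?_ <;> rw [h0] <;> nlinarith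
  have hv := B.vertical_subset j ((l : ℤ) + 1 / 2) ((l + 1 : ℤ) + 1 / 2)
  have hv1 := B.vertical_subset j ((l : ℤ) + 1 / 2) (l + 1 : ℤ)
  have hv2 := B.vertical_subset j (l + 1 : ℤ) ((l + 1 : ℤ) + 1 / 2)
  have hc1 := B.horizontal_subset ((k : ℤ) + 1 / 2) w l
  have hc2 := B.horizontal_subset w ((k : ℤ) + 1 / 2) (l + 1)
  let bot : B.liftedTable := ⟨!₂[w, (l : ℝ) + 1 / 2], midline_mem w l⟩
  let top : B.liftedTable := ⟨!₂[w, ((l + 1 : ℤ) : ℝ) + 1 / 2], midline_mem w (l + 1)⟩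
  let mid : B.liftedTable := ⟨M, hseg (right_mem_segment ℝ _ _)⟩
  have hbot : bot ∈ B.strip l := by constructor <;> simp [bot]; norm_num
  have htop : top ∈ B.strip (l + 1) := by constructor <;> simp [top]; norm_num
  have hmid : mid ∈ B.strip l := by constructor <;> simp [mid, M]
  have hmid' : mid ∈ B.strip (l + 1) := by constructor <;> simp [mid, M]
  let γ₁ : Path (B.cellCenter k l) bot := B.linePath hc1
  let γ₂ : Path bot mid := B.linePath hv1
  let γ₃ : Path mid top := B.linePath hv2
  let γ₄ : Path top (B.cellCenter k (l + 1)) := B.linePath hc2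
  let δ : Path p mid := B.linePath hseg
  have e₁ : Path.Homotopic.Quotient.mk γ₁ = stripClass (B.cellCenter_mem_strip k l) hbot :=
    mk_eq_stripClass _ (linePath_mem_strip (l := l) _ (by constructor <;> simp; norm_num)
      (by constructor <;> simp; norm_num)) _ _
  have e₂ : Path.Homotopic.Quotient.mk γ₂ = stripClass hbot hmid :=
    mk_eq_stripClass _ (linePath_mem_strip (l := l) _ (by constructor <;> simp; norm_num)
      (by constructor <;> simp)) _ _
  have e₃ : Path.Homotopic.Quotient.mk γ₃ = stripClass hmid' htop :=
    mk_eq_stripClass _ (linePath_mem_strip (l := l + 1) _ (by constructor <;> simp)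
      (by constructor <;> simp; norm_num)) _ _
  have e₄ : Path.Homotopic.Quotient.mk γ₄
      = stripClass htop (B.cellCenter_mem_strip k (l + 1)) :=
    mk_eq_stripClass _ (linePath_mem_strip (l := l + 1) _ (by constructor <;> simp; norm_num)
      (by constructor <;> simp; norm_num)) _ _
  -- the part of the wall between `p` and its midpoint lies in both strips
  have e₅ : stripClass hp hmid = Path.Homotopic.Quotient.mk δ :=
    (mk_eq_stripClass _ (linePath_mem_strip (l := l) _ hp hmid) _ _).symm
  have e₆ : stripClass hp' hmid' = Path.Homotopic.Quotient.mk δ :=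
    (mk_eq_stripClass _ (linePath_mem_strip (l := l + 1) _ hp' hmid') _ _).symm
  have key : (stripClass (B.cellCenter_mem_strip k l) hp).trans
      (stripClass hp' (B.cellCenter_mem_strip k (l + 1)))
      = Path.Homotopic.Quotient.mk ((γ₁.trans (γ₂.trans γ₃)).trans γ₄) := by
    rw [Path.Homotopic.Quotient.mk_trans, Path.Homotopic.Quotient.mk_trans,
      Path.Homotopic.Quotient.mk_trans, e₁, e₂, e₃, e₄, ← Path.Homotopic.Quotient.trans_assoc,
      stripClass_trans, Path.Homotopic.Quotient.trans_assoc, stripClass_trans,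
      ← stripClass_trans hp' hmid', e₆, ← e₅, ← Path.Homotopic.Quotient.trans_assoc,
      stripClass_trans]
  rw [key]
  have hγ : γ₂.trans γ₃ = B.linePath hv := by
    refine (linePath_eq_trans hv hv1 hv2 ?_).symm
    ext z
    fin_cases z <;> simp [midpoint_eq_smul_add] <;> ring
  rw [hγ]
  change _ = B.liftClass (Path.Homotopic.Quotient.mk
    (((B.linePath (B.horizontal_subset ((0 : ℤ) + 1 / 2) (((i : ℤ) + 1 / 2) / B.n) 0)).trans
      (B.linePath (B.vertical_subset i ((0 : ℤ) + 1 / 2) ((1 : ℤ) + 1 / 2)))).trans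
      (B.linePath (B.horizontal_subset (((i : ℤ) + 1 / 2) / B.n) ((0 : ℤ) + 1 / 2) 1))))
      (B.proj_cellCenter 0 0) (B.proj_cellCenter 0 1)
  have hw : w = (((i : ℤ) : ℝ) + 1 / 2) / B.n + k := by
    simp only [w, hj]
    push_cast
    field_simp
    ring
  refine liftClass_mk_eq_of_proj_eq _ _ _ _ (proj_trans_eq (proj_trans_eq ?_ ?_) ?_) <;>
    refine fun t => proj_linePath_eq _ _ k l ?_ ?_ ?_ ?_ t
  all_goals first | exact hw | (simp; ring)

end BilliardTable

namespace BilliardTable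
namespace Trajectory

variable {B : BilliardTable} (x : B.Trajectory)

/-! ### Vertical motion of trajectories -/

/-- The motion has unit speed, so the distance between two positions is at most the time that
passes between them. -/
theorem dist_pos_le {s t : ℝ} (h : s ≤ t) : dist (x.pos t) (x.pos s) ≤ t - s := by
  have hd : ∀ u ∈ Set.Ico s t, HasDerivWithinAt x.pos (x.velAfter u) (Set.Ici u) u := by
    intro u _
    rw [← hasDerivWithinAt_Ioi_iff_Ici]
    have : HasDerivWithinAt (fun v => x.pos u + (v - u) • x.velAfter u) (x.velAfter u)
        (Set.Ioi u) u := by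
      have h1 := (((hasDerivAt_id u).sub_const u).smul_const (x.velAfter u)).const_add (x.pos u)
      simpa using h1.hasDerivWithinAt
    exact this.congr_of_eventuallyEq (x.motion_after u) (by simp)
  have := norm_image_sub_le_of_norm_deriv_right_le_segment (C := 1) x.continuous_pos.continuousOn hd
    (fun u _ => (x.unit_speed u).le) t ⟨h, le_rfl⟩
  rwa [one_mul, ← dist_eq_norm] at this

/-- A moving point cannot arrive at a scatterer from its inside. -/
theorem inner_velBefore_nonpos {t : ℝ} {k l : ℤ} (h : dist (x.pos t) (B.center k l) = B.r) :
    inner ℝ (x.velBefore t) (x.pos t - B.center k l) ≤ 0 := by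
  set c := B.center k l
  have hev : ∀ᶠ s in 𝓝[<] t, 2 * inner ℝ (x.velBefore t) (x.pos t - c)
      ≤ (t - s) * ‖x.velBefore t‖ ^ 2 := by
    filter_upwards [x.motion_before t, self_mem_nhdsWithin] with s hs hst
    have hst : s < t := hst
    have hm := x.pos_mem s k l
    have h1 : B.r ^ 2 ≤ ‖x.pos s - c‖ ^ 2 := by
      rw [← dist_eq_norm]
      exact pow_le_pow_left₀ B.r_pos.le hm 2
    have h2 : x.pos s - c = (x.pos t - c) + (s - t) • x.velBefore t := by rw [hs]; abel
    rw [h2, norm_add_sq_real, ← dist_eq_norm, h, inner_smul_right, norm_smul,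
      real_inner_comm, mul_pow, Real.norm_eq_abs, sq_abs] at h1
    nlinarith
  have hlim : Tendsto (fun s => (t - s) * ‖x.velBefore t‖ ^ 2) (𝓝[<] t) (𝓝 0) := by
    have : Continuous fun s : ℝ => (t - s) * ‖x.velBefore t‖ ^ 2 := by fun_prop
    have := this.tendsto t
    rw [sub_self, zero_mul] at this
    exact this.mono_left nhdsWithin_le_nhds
  have := ge_of_tendsto hlim hev
  linarith

/-- Where the vertical velocity (measured in the direction `σ = ±1`) decreases, the point hits a
scatterer whose centre is further in that direction. -/
theorem exists_center_of_velAfter_lt {t σ : ℝ} (h : σ * x.velAfter t 1 < σ * x.velBefore t 1) :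
    ∃ m : ℤ, 0 < σ * (m - x.pos t 1) ∧ |m - x.pos t 1| ≤ B.r := by
  by_cases hfree : ∀ k l : ℤ, dist (x.pos t) (B.center k l) ≠ B.r
  · rw [x.free t hfree] at h
    exact absurd h (lt_irrefl _)
  push Not at hfree
  obtain ⟨k, l, hkl⟩ := hfree
  have hr := B.r_pos
  have hv := congrArg (fun v : Plane => v 1) (x.reflection t k l hkl)
  have hin := x.inner_velBefore_nonpos hkl
  simp only [PiLp.sub_apply, PiLp.smul_apply, smul_eq_mul, inner_smul_right] at hv
  have hc : B.center k l 1 = l := rfl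
  rw [hc] at hv
  refine ⟨l, ?_, ?_⟩
  · rw [hv] at h
    generalize inner ℝ (x.velBefore t) (x.pos t - B.center k l) = z at *
    have h3 : 0 < (2 / B.r ^ 2) * (z * (σ * (x.pos t 1 - l))) := by
      have : (2 / B.r ^ 2) * (z * (σ * (x.pos t 1 - l)))
        = σ * (2 * (1 / B.r * z) * (1 / B.r * (x.pos t 1 - l))) := by
        field_simp
      rw [this]; nlinarith
    have h4 : 0 < z * (σ * (x.pos t 1 - l)) := by
      by_contra! h4
      have : 0 < 2 / B.r ^ 2 := by positivity
      nlinarith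
    nlinarith
  · rw [dist_center] at hkl
    rw [abs_sub_comm, ← hkl]
    exact Real.abs_le_sqrt (by nlinarith [sq_nonneg (x.pos t 0 - k / B.n)])

theorem eventually_pos_one_after (t : ℝ) :
    ∀ᶠ s in 𝓝[>] t, x.pos s 1 = x.pos t 1 + (s - t) * x.velAfter t 1 := by
  filter_upwards [x.motion_after t] with s hs
  rw [hs]; simp

theorem eventually_pos_one_before (t : ℝ) :
    ∀ᶠ s in 𝓝[<] t, x.pos s 1 = x.pos t 1 + (s - t) * x.velBefore t 1 := by
  filter_upwards [x.motion_before t] with s hs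
  rw [hs]; simp

theorem continuous_pos_one : Continuous fun t => x.pos t 1 :=
  (show Continuous fun p : Plane => p 1 by fun_prop).comp x.continuous_pos

/-- A trajectory which leaves the line `y = l` and comes back to it has moved away from it by at
least `1 / 2`: while it is closer to the line, the scatterers can only push it further away. -/
theorem exists_half_le_of_return {s t σ : ℝ} {l : ℤ} (hst : s ≤ t) (hσ : σ = 1 ∨ σ = -1)
    (hs : x.pos s 1 = l) (ht : x.pos t 1 = l)
    (hex : ∃ u ∈ Set.Icc s t, 0 < σ * (x.pos u 1 - l)) :
    ∃ u ∈ Set.Icc s t, 1 / 2 ≤ σ * (x.pos u 1 - l) := by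
  have hcont := x.continuous_pos_one
  set f : ℝ → ℝ := fun u => σ * (x.pos u 1 - l) with hf
  have hfc : Continuous f := continuous_const.mul (hcont.sub continuous_const)
  obtain ⟨u₀, hu₀, hpos⟩ := hex
  obtain ⟨u₁, hu₁, hmax⟩ := isCompact_Icc.exists_isMaxOn (Set.nonempty_Icc.2 hst)
    hfc.continuousOn
  -- the last time at which the distance to the line is maximal
  obtain ⟨u, ⟨hu, hfu⟩, hlast⟩ := (isCompact_Icc.inter_right
    (isClosed_eq hfc (continuous_const (y := f u₁)))).exists_isGreatest ⟨u₁, hu₁, rfl⟩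
  have hfu : f u = f u₁ := hfu
  have hfpos : 0 < f u := by rw [hfu]; exact hpos.trans_le (hmax hu₀)
  have hle : ∀ v ∈ Set.Icc s t, f v ≤ f u := fun v hv => by rw [hfu]; exact hmax hv
  have hsu : s < u := lt_of_le_of_ne hu.1 (by rintro rfl; simp [hf, hs] at hfpos)
  have hut : u < t := lt_of_le_of_ne hu.2 (by rintro rfl; simp [hf, ht] at hfpos)
  have hbefore : 0 ≤ σ * x.velBefore u 1 := by
    obtain ⟨v, hv, hsv, hvu⟩ :=
      ((x.eventually_pos_one_before u).and (Ioo_mem_nhdsLT hsu)).exists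
    have h1 := hle v ⟨hsv.le, hvu.le.trans hu.2⟩
    simp only [hf, hv] at h1
    nlinarith
  have hafter : σ * x.velAfter u 1 < 0 := by
    obtain ⟨v, hv, huv, hvt⟩ :=
      ((x.eventually_pos_one_after u).and (Ioo_mem_nhdsGT hut)).exists
    have hvI : v ∈ Set.Icc s t := ⟨hu.1.trans huv.le, hvt.le⟩
    have h1 : f v < f u := lt_of_le_of_ne (hle v hvI) fun h =>
      absurd (hlast ⟨hvI, h.trans hfu⟩) (not_le.2 huv)
    simp only [hf, hv] at h1
    nlinarith
  obtain ⟨m, hm, hmr⟩ := x.exists_center_of_velAfter_lt (hafter.trans_le hbefore)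
  refine ⟨u, hu, ?_⟩
  have hr := B.r_lt_half
  simp only [hf] at hfpos
  rw [abs_le] at hmr
  rcases hσ with rfl | rfl
  · have : (l : ℝ) < m := by linarith
    have : (l : ℝ) + 1 ≤ m := by exact_mod_cast this
    linarith
  · have : (m : ℝ) < l := by linarith
    have : (m : ℝ) + 1 ≤ l := by exact_mod_cast this
    linarith

/-- The trajectory is at time `t` on the boundary of the strip `l ≤ y ≤ l + 1` and about to move
into its interior. -/
def Enters (t : ℝ) (l : ℤ) : Prop :=
  (x.pos t 1 = l ∧ 0 < x.velAfter t 1) ∨ (x.pos t 1 = l + 1 ∧ x.velAfter t 1 < 0)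

/-- The trajectory is at time `t` on the boundary of the strip `l ≤ y ≤ l + 1` and about to move
out of it. -/
def Leaves (t : ℝ) (l : ℤ) : Prop :=
  (x.pos t 1 = l + 1 ∧ 0 < x.velAfter t 1) ∨ (x.pos t 1 = l ∧ x.velAfter t 1 < 0)

/-- A trajectory which is in the strip `l ≤ y ≤ l + 1` at time `s` stays there up to time `t` or
up to a moment `u` at which it leaves the strip with non-zero vertical velocity. -/
theorem exists_exit {s t : ℝ} (l : ℤ) (hst : s ≤ t) (h1 : (l : ℝ) ≤ x.pos s 1)
    (h2 : x.pos s 1 ≤ l + 1) :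
    ∃ u ∈ Set.Icc s t, (∀ v ∈ Set.Icc s u, (l : ℝ) ≤ x.pos v 1 ∧ x.pos v 1 ≤ l + 1) ∧
      (u = t ∨ x.Leaves u l) := by
  have hcont := x.continuous_pos_one
  set A : Set ℝ := {u | u ∈ Set.Icc s t ∧
    ∀ v ∈ Set.Icc s u, (l : ℝ) ≤ x.pos v 1 ∧ x.pos v 1 ≤ l + 1} with hA
  have hsA : s ∈ A := ⟨⟨le_rfl, hst⟩, fun v hv => by
    obtain rfl : v = s := le_antisymm hv.2 hv.1
    exact ⟨h1, h2⟩⟩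
  have hbdd : BddAbove A := ⟨t, fun u hu => hu.1.2⟩
  set u := sSup A with hu
  have hsu : s ≤ u := le_csSup hbdd hsA
  have hut : u ≤ t := csSup_le ⟨s, hsA⟩ fun v hv => hv.1.2
  have hlt : ∀ v ∈ Set.Ico s u, (l : ℝ) ≤ x.pos v 1 ∧ x.pos v 1 ≤ l + 1 := by
    intro v hv
    obtain ⟨w, hw, hvw⟩ := exists_lt_of_lt_csSup ⟨s, hsA⟩ hv.2
    exact hw.2 v ⟨hv.1, hvw.le⟩
  have hclosed : IsClosed {v | (l : ℝ) ≤ x.pos v 1 ∧ x.pos v 1 ≤ l + 1} :=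
    (isClosed_le continuous_const hcont).inter (isClosed_le hcont continuous_const)
  have huA : ∀ v ∈ Set.Icc s u, (l : ℝ) ≤ x.pos v 1 ∧ x.pos v 1 ≤ l + 1 := by
    rcases hsu.eq_or_lt with h | h
    · rw [← h]; exact hsA.2
    · intro v hv
      rw [← closure_Ico h.ne] at hv
      exact closure_minimal hlt hclosed hv
  refine ⟨u, ⟨hsu, hut⟩, huA, ?_⟩
  unfold Leaves
  by_contra! hcon
  obtain ⟨hne, hup, hdown⟩ := hcon
  have hut : u < t := lt_of_le_of_ne hut hne
  -- otherwise the trajectory stays in the strip for a moment longer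
  have hev : ∀ᶠ v in 𝓝[>] u, (l : ℝ) ≤ x.pos v 1 ∧ x.pos v 1 ≤ l + 1 := by
    have hat := hcont.tendsto u
    refine Filter.Eventually.and ?_ ?_
    · rcases (huA u ⟨hsu, le_rfl⟩).1.eq_or_lt with h | h
      · filter_upwards [x.eventually_pos_one_after u, self_mem_nhdsWithin] with v hv huv
        have := hdown h.symm
        have huv : u < v := huv
        rw [hv]
        nlinarith
      · filter_upwards [nhdsWithin_le_nhds (hat.eventually_const_lt h)] with v hv using hv.le
    · rcases (huA u ⟨hsu, le_rfl⟩).2.eq_or_lt with h | h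
      · filter_upwards [x.eventually_pos_one_after u, self_mem_nhdsWithin] with v hv huv
        have := hup h
        have huv : u < v := huv
        rw [hv]
        nlinarith
      · filter_upwards [nhdsWithin_le_nhds (hat.eventually_lt_const h)] with v hv using hv.le
  obtain ⟨w, huw : u < w, hw⟩ := mem_nhdsGT_iff_exists_Ioc_subset.1 hev
  have hmem : min w t ∈ A := by
    refine ⟨⟨hsu.trans (le_min huw.le hut.le), min_le_right _ _⟩, fun v hv => ?_⟩
    rcases le_or_gt v u with h | h
    · exact huA v ⟨hv.1, h⟩
    · exact hw ⟨h, hv.2.trans (min_le_left _ _)⟩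
  exact absurd (le_csSup hbdd hmem) (not_le.2 (lt_min huw hut))

end Trajectory
end BilliardTable

namespace BilliardTable

variable {B : BilliardTable}

/-! ### Words for trajectory segments -/

/-- The group element `g` is spelled by a word whose reduced length is at most `L`. -/
def HasWord (g : B.Pi1) (L : ℝ) : Prop :=
  ∃ w : FreeGroup (Option (Fin B.n)), B.evalWord w = g ∧ (w.norm : ℝ) ≤ L

theorem HasWord.mono {g : B.Pi1} {L L' : ℝ} (h : HasWord g L) (hL : L ≤ L') : HasWord g L' := by
  obtain ⟨w, hw, hn⟩ := h
  exact ⟨w, hw, hn.trans hL⟩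

theorem HasWord.mul {g g' : B.Pi1} {L L' : ℝ} (h : HasWord g L) (h' : HasWord g' L') :
    HasWord (g * g') (L + L') := by
  obtain ⟨w, rfl, hn⟩ := h
  obtain ⟨w', rfl, hn'⟩ := h'
  refine ⟨w * w', map_mul _ _ _, ?_⟩
  have : ((w * w').norm : ℝ) ≤ w.norm + w'.norm := by exact_mod_cast FreeGroup.norm_mul_le w w'
  linarith

theorem HasWord.inv {g : B.Pi1} {L : ℝ} (h : HasWord g L) : HasWord g⁻¹ L := by
  obtain ⟨w, rfl, hn⟩ := h
  exact ⟨w⁻¹, map_inv _ _, by rwa [FreeGroup.norm_inv_eq]⟩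

theorem hasWord_generator (o : Option (Fin B.n)) : HasWord (B.generator o) 1 :=
  ⟨FreeGroup.of o, FreeGroup.lift_apply_of .., by simp⟩

theorem hasWord_zpow (o : Option (Fin B.n)) (m : ℤ) : HasWord (B.generator o ^ m) |(m : ℝ)| := by
  refine ⟨FreeGroup.of o ^ m, by rw [map_zpow]; congr 1; exact FreeGroup.lift_apply_of .., ?_⟩
  obtain ⟨k, rfl | rfl⟩ := m.eq_nat_or_neg
  · simp [FreeGroup.norm_of_pow]
  · simp [FreeGroup.norm_of_pow]

namespace Trajectory

variable (x : B.Trajectory)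

theorem continuous_point : Continuous x.point := x.continuous_pos.subtype_mk _

/-- The homotopy class of the part of the trajectory between two times. -/
def timeClass (s t : ℝ) : Path.Homotopic.Quotient (x.point s) (x.point t) :=
  Path.Homotopic.Quotient.mk ((Path.segment s t).map x.continuous_point)

/-- Times are real numbers, and `ℝ` is simply connected; so no order of the times is needed. -/
theorem timeClass_trans (s t u : ℝ) :
    (x.timeClass s t).trans (x.timeClass t u) = x.timeClass s u := by
  rw [timeClass, timeClass, timeClass, ← Path.Homotopic.Quotient.mk_trans, ← Path.map_trans,
    Path.Homotopic.Quotient.eq]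
  exact (SimplyConnectedSpace.paths_homotopic ((Path.segment s t).trans (Path.segment t u))
    (Path.segment s u)).map ⟨x.point, x.continuous_point⟩

theorem timeClass_eq_stripClass {s t : ℝ} {l : ℤ} (hst : s ≤ t)
    (h : ∀ v ∈ Set.Icc s t, x.point v ∈ B.strip l) (hs : x.point s ∈ B.strip l)
    (ht : x.point t ∈ B.strip l) : x.timeClass s t = stripClass hs ht := by
  refine mk_eq_stripClass _ (fun v => h _ ?_) _ _
  rw [← segment_eq_Icc hst, ← Path.range_segment]
  exact Set.mem_range_self v

/-- The class of the trajectory between the times `s` and `t`, closed up to a loop by joining its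
ends to cell centres within the strips `k` and `l`. On a line `y = l` a point belongs to two strips,
so the strips have to be chosen. -/
def cellClass (s t : ℝ) {k l : ℤ} (hs : x.point s ∈ B.strip k) (ht : x.point t ∈ B.strip l) :
    B.Pi1 :=
  B.liftClass ((stripClass (B.cellCenter_mem_strip ⌊x.pos s 0⌋ k) hs).trans
    ((x.timeClass s t).trans (stripClass ht (B.cellCenter_mem_strip ⌊x.pos t 0⌋ l))))
    (B.proj_cellCenter _ _) (B.proj_cellCenter _ _)

theorem cellClass_mul {s t u : ℝ} {k l m : ℤ} (hs : x.point s ∈ B.strip k)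
    (ht : x.point t ∈ B.strip l) (hu : x.point u ∈ B.strip m) :
    x.cellClass s t hs ht * x.cellClass t u ht hu = x.cellClass s u hs hu := by
  rw [cellClass, cellClass, ← liftClass_trans, cellClass, ← x.timeClass_trans s t u]
  congr 1
  simp only [Path.Homotopic.Quotient.trans_assoc]
  congr 2
  rw [← Path.Homotopic.Quotient.trans_assoc (stripClass ht _), stripClass_trans, stripClass_self,
    Path.Homotopic.Quotient.refl_trans]

theorem cellClass_eq_zpow {s t : ℝ} {l : ℤ} (hst : s ≤ t)
    (h : ∀ v ∈ Set.Icc s t, x.point v ∈ B.strip l) (hs : x.point s ∈ B.strip l)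
    (ht : x.point t ∈ B.strip l) :
    x.cellClass s t hs ht = B.generator none ^ (⌊x.pos t 0⌋ - ⌊x.pos s 0⌋) := by
  rw [cellClass, x.timeClass_eq_stripClass hst h hs ht, stripClass_trans, stripClass_trans,
    liftClass_stripClass]

theorem cellClass_self {t : ℝ} {l : ℤ} (ht : x.point t ∈ B.strip l) :
    x.cellClass t t ht ht = 1 := by
  rw [x.cellClass_eq_zpow le_rfl (fun v hv => by rwa [le_antisymm hv.2 hv.1]), sub_self, zpow_zero]

theorem hasWord_cellClass_refl {t : ℝ} {l : ℤ} (ht : x.point t ∈ B.strip l) :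
    HasWord (x.cellClass t t ht ht) 0 := by
  rw [cellClass_self]
  exact ⟨1, map_one _, by simp⟩

/-- Changing over to the strip above costs the generator of the wall on which the point is. -/
theorem exists_cellClass_eq_generator {t : ℝ} {l : ℤ} (ht : x.point t ∈ B.strip l)
    (ht' : x.point t ∈ B.strip (l + 1)) :
    ∃ i : Fin B.n, x.cellClass t t ht ht' = B.generator (some i) := by
  have hn : (0 : ℤ) < B.n := by exact_mod_cast B.n_pos
  set j : ℤ := ⌊B.n * x.pos t 0⌋ with hj
  have hk : ⌊x.pos t 0⌋ = j / B.n := by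
    rw [hj, ← Int.floor_div_natCast, mul_div_cancel_left₀ _ (Nat.cast_ne_zero.2 B.n_pos.ne')]
  have hnat : ((j % B.n).toNat : ℤ) = j % B.n := Int.toNat_of_nonneg (Int.emod_nonneg _ hn.ne')
  have hlt := Int.emod_lt_of_pos j hn
  refine ⟨⟨(j % B.n).toNat, by omega⟩, ?_⟩
  rw [← liftClass_stripClass_crossing ⌊x.pos t 0⌋ l ⟨(j % B.n).toNat, by omega⟩ ht ht'
    (by rw [hk]; dsimp only; rw [hnat, Int.emod_add_mul_ediv]; rfl), cellClass,
    x.timeClass_eq_stripClass le_rfl (fun v hv => by rwa [le_antisymm hv.2 hv.1]) ht' ht',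
    stripClass_trans]

theorem hasWord_cellClass_self {t : ℝ} {l m : ℤ} (ht : x.point t ∈ B.strip l)
    (ht' : x.point t ∈ B.strip m) : HasWord (x.cellClass t t ht ht') 1 := by
  have h1 : (l : ℝ) ≤ m + 1 := ht.1.trans ht'.2
  have h2 : (m : ℝ) ≤ l + 1 := ht'.1.trans ht.2
  have h1 : l ≤ m + 1 := by exact_mod_cast h1
  have h2 : m ≤ l + 1 := by exact_mod_cast h2
  obtain rfl | rfl | rfl : m = l ∨ m = l + 1 ∨ l = m + 1 := by omega
  · exact (x.hasWord_cellClass_refl ht).mono zero_le_one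
  · obtain ⟨i, hi⟩ := x.exists_cellClass_eq_generator ht ht'
    rw [hi]
    exact hasWord_generator _
  · obtain ⟨i, hi⟩ := x.exists_cellClass_eq_generator ht' ht
    have : x.cellClass t t ht ht' = (B.generator (some i))⁻¹ := by
      rw [eq_inv_iff_mul_eq_one, ← hi, cellClass_mul, cellClass_self]
    rw [this]
    exact (hasWord_generator _).inv

theorem hasWord_cellClass_of_strip {s t : ℝ} {l : ℤ} (hst : s ≤ t)
    (h : ∀ v ∈ Set.Icc s t, x.point v ∈ B.strip l) (hs : x.point s ∈ B.strip l)
    (ht : x.point t ∈ B.strip l) :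
    HasWord (x.cellClass s t hs ht) (|x.pos t 0 - x.pos s 0| + 1) := by
  rw [x.cellClass_eq_zpow hst h]
  refine (hasWord_zpow _ _).mono ?_
  have h1 := Int.floor_le (x.pos t 0)
  have h2 := Int.lt_floor_add_one (x.pos t 0)
  have h3 := Int.floor_le (x.pos s 0)
  have h4 := Int.lt_floor_add_one (x.pos s 0)
  push_cast
  rw [abs_le]
  constructor <;> cases abs_cases (x.pos t 0 - x.pos s 0) <;> linarith

/-- The connecting paths in the definition of `homotopyClass` stay in the strips of the ends. -/
theorem homotopyClass_eq_cellClass (T : ℝ) :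
    x.homotopyClass T = x.cellClass 0 T
      (mem_strip_floor (x.point 0)) (mem_strip_floor (x.point T)) := by
  let c (p : B.liftedTable) : Path (B.cellCenter ⌊p.1 0⌋ ⌊p.1 1⌋) p :=
    (B.linePath (B.horizontal_subset ((⌊p.1 0⌋ : ℝ) + 1 / 2) (p.1 0) ⌊p.1 1⌋)).trans
      (B.linePath (B.drop_subset p))
  have hc (p : B.liftedTable) : Path.Homotopic.Quotient.mk (c p)
      = stripClass (B.cellCenter_mem_strip _ _) (mem_strip_floor p) := by
    refine mk_eq_stripClass _ (fun t => ?_) _ _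
    rw [show c p t = _ from Path.trans_apply _ _ t]
    split_ifs
    · exact linePath_mem_strip _ (by constructor <;> simp; norm_num)
        (by constructor <;> simp; norm_num) _
    · exact linePath_mem_strip _ (by constructor <;> simp; norm_num) (mem_strip_floor p) _
  have hseg : x.timeClass 0 T = Path.Homotopic.Quotient.mk (x.segmentPath T) := by
    rw [timeClass]
    congr 1
    refine Path.ext (funext fun t => ?_)
    simp [segmentPath, AffineMap.lineMap_apply]
    rfl
  refine Eq.trans ?_ ((congrArg₂
    (fun a b => B.liftClass ((Path.Homotopic.Quotient.trans a
      (Path.Homotopic.Quotient.mk (x.segmentPath T))).trans (Path.Homotopic.Quotient.symm b))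
      (B.proj_cellCenter _ _) (B.proj_cellCenter _ _)) (hc (x.point 0)) (hc (x.point T))).trans ?_)
  swap
  · rw [stripClass_symm, Path.Homotopic.Quotient.trans_assoc, ← hseg]
    rfl
  rw [homotopyClass, ← Path.Homotopic.Quotient.mk_symm, ← Path.Homotopic.Quotient.mk_trans,
    ← Path.Homotopic.Quotient.mk_trans, liftClass_mk]
  congr 1
  refine Path.ext (funext fun t => ?_)
  change (((B.connector (x.point 0)).trans ((x.segmentPath T).map B.continuous_proj)).trans
    (B.connector (x.point T)).symm) t
      = B.proj (((c (x.point 0)).trans (x.segmentPath T)).trans (c (x.point T)).symm t)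
  rw [Path.trans_apply, Path.trans_apply]
  split_ifs
  · rw [Path.trans_apply, Path.trans_apply]
    split_ifs <;> rfl
  · rfl

/-! ### Lengths of the passages through the strips -/

theorem dist_sq_le {s t : ℝ} (h : s ≤ t) :
    (x.pos t 0 - x.pos s 0) ^ 2 + (x.pos t 1 - x.pos s 1) ^ 2 ≤ (t - s) ^ 2 := by
  have h1 := pow_le_pow_left₀ dist_nonneg (x.dist_pos_le h) 2
  rwa [EuclideanSpace.dist_sq_eq, Fin.sum_univ_two, Real.dist_eq, Real.dist_eq, sq_abs,
    sq_abs] at h1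

theorem Leaves.exists_enters {x : B.Trajectory} {t : ℝ} {l : ℤ} (h : x.Leaves t l) :
    ∃ l', x.Enters t l' := by
  rcases h with ⟨h, hv⟩ | ⟨h, hv⟩
  · exact ⟨l + 1, Or.inl ⟨by push_cast; exact h, hv⟩⟩
  · exact ⟨l - 1, Or.inr ⟨by push_cast; linarith, hv⟩⟩

theorem Enters.mem_strip {x : B.Trajectory} {t : ℝ} {l : ℤ} (h : x.Enters t l) :
    x.point t ∈ B.strip l := by
  rcases h with ⟨h, -⟩ | ⟨h, -⟩ <;> constructor <;>
    simp [point, h]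

/-- Minkowski's inequality for the vectors `(a, h)` and `(b, h)`: their lengths add up to at least
the hypotenuse with legs `a + b` and `2 h`. -/
theorem _root_.add_sq_add_sq_le_of_sq_add_sq_le {a b h s t : ℝ} (hs0 : 0 ≤ s) (ht0 : 0 ≤ t)
    (hs : a ^ 2 + h ^ 2 ≤ s ^ 2) (ht : b ^ 2 + h ^ 2 ≤ t ^ 2) :
    (a + b) ^ 2 + 4 * h ^ 2 ≤ (s + t) ^ 2 := by
  have : (a * b + h ^ 2) ^ 2 ≤ (s * t) ^ 2 := by
    have := mul_le_mul hs ht (by positivity) (by positivity)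
    nlinarith [sq_nonneg (h * (a - b))]
  have := abs_le_of_sq_le_sq' this (by positivity)
  nlinarith

/-- A trajectory that leaves the line `y = l` on the side `σ` and comes back to it climbs to height
at least `1 / 2` and down again. -/
theorem return_length {s t σ : ℝ} {l : ℤ} (hst : s ≤ t) (hσ : σ = 1 ∨ σ = -1)
    (hs : x.pos s 1 = l) (ht : x.pos t 1 = l) (hvs : 0 < σ * x.velAfter s 1)
    (hvt : σ * x.velAfter t 1 < 0) :
    (x.pos t 0 - x.pos s 0) ^ 2 + 1 ≤ (t - s) ^ 2 := by
  have hlt : s < t := lt_of_le_of_ne hst (by rintro rfl; linarith)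
  obtain ⟨v, hv, hsv, hvt'⟩ :=
    ((x.eventually_pos_one_after s).and (Ioo_mem_nhdsGT hlt)).exists
  obtain ⟨u, hu, hhalf⟩ := x.exists_half_le_of_return hst hσ hs ht
    ⟨v, ⟨hsv.le, hvt'.le⟩, by rw [hv, hs]; nlinarith [mul_pos (sub_pos.2 hsv) hvs]⟩
  have h1 := x.dist_sq_le hu.1
  have h2 := x.dist_sq_le hu.2
  rw [hs] at h1
  rw [ht, ← neg_sq ((l : ℝ) - _), neg_sub] at h2
  have h3 : (1 / 2 : ℝ) ^ 2 ≤ (x.pos u 1 - l) ^ 2 := by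
    have := pow_le_pow_left₀ (by norm_num) hhalf 2
    rcases hσ with rfl | rfl <;> linarith
  have := add_sq_add_sq_le_of_sq_add_sq_le (sub_nonneg.2 hu.1) (sub_nonneg.2 hu.2) h1 h2
  have e1 : x.pos u 0 - x.pos s 0 + (x.pos t 0 - x.pos u 0) = x.pos t 0 - x.pos s 0 := by ring
  have e2 : u - s + (t - u) = t - s := by ring
  rw [e1, e2] at this
  linarith

/-- A passage through a strip either connects its two boundary lines or returns to the line that
it came from; in both cases it is at least as long as a straight path with the same horizontal
displacement that crosses the strip. -/
theorem passage_length {s t : ℝ} {l : ℤ} (hst : s ≤ t) (hs : x.Enters s l) (ht : x.Leaves t l) :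
    (x.pos t 0 - x.pos s 0) ^ 2 + 1 ≤ (t - s) ^ 2 := by
  have hd := x.dist_sq_le hst
  rcases hs with ⟨hs, hvs⟩ | ⟨hs, hvs⟩ <;> rcases ht with ⟨ht, hvt⟩ | ⟨ht, hvt⟩
  · rw [hs, ht] at hd
    linarith
  · exact x.return_length hst (Or.inl rfl) hs ht (by linarith) (by linarith)
  · refine x.return_length (l := l + 1) hst (Or.inr rfl) ?_ ?_ (by linarith) (by linarith)
    · push_cast; exact hs
    · push_cast; exact ht
  · rw [hs, ht] at hd
    linarith

/-- A passage takes at least one unit of time, and the number of its letters (one for the line at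
its end and at most `|Δx| + 1` for the vertical walls) is at most `2√2` times its duration, because
`(u + 2)² ≤ 5 (u² + 1)` by the Cauchy-Schwarz inequality. -/
theorem passage_letters {s t : ℝ} {l : ℤ} (hst : s ≤ t) (hs : x.Enters s l) (ht : x.Leaves t l) :
    1 ≤ t - s ∧ |x.pos t 0 - x.pos s 0| + 2 ≤ 2 * Real.sqrt 2 * (t - s) := by
  have h := x.passage_length hst hs ht
  rw [← sq_abs] at h
  have h0 : 0 ≤ t - s := sub_nonneg.2 hst
  refine ⟨by nlinarith [sq_nonneg |x.pos t 0 - x.pos s 0|], ?_⟩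
  refine (abs_le_of_sq_le_sq' ?_ (by positivity)).2
  have h2 : Real.sqrt 2 ^ 2 = 2 := Real.sq_sqrt (by norm_num)
  rw [mul_pow, mul_pow, h2]
  -- the square below is the defect in `(u + 2)² ≤ 5 (u² + 1)`
  nlinarith [sq_nonneg (2 * |x.pos t 0 - x.pos s 0| - 1), sq_nonneg |x.pos t 0 - x.pos s 0|]

/-- If the trajectory stays in the strip `l` until time `u`, this part contributes at most
`|Δx| + 1` letters `a` and one letter for the change to the strip `l'`. -/
theorem hasWord_cellClass_of_exit {s u t L : ℝ} {l l' m : ℤ} (hsu : s ≤ u)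
    (h : ∀ v ∈ Set.Icc s u, x.point v ∈ B.strip l) (hs : x.point s ∈ B.strip l)
    (hu : x.point u ∈ B.strip l') (ht : x.point t ∈ B.strip m)
    (hw : HasWord (x.cellClass u t hu ht) L) :
    HasWord (x.cellClass s t hs ht) (|x.pos u 0 - x.pos s 0| + 2 + L) := by
  have hu' : x.point u ∈ B.strip l := h u ⟨hsu, le_rfl⟩
  rw [← x.cellClass_mul hs hu ht, ← x.cellClass_mul hs hu' hu]
  exact (((x.hasWord_cellClass_of_strip hsu h hs hu').mul
    (x.hasWord_cellClass_self hu' hu)).mul hw).mono (by linarith)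

theorem abs_sub_le {s t : ℝ} (hst : s ≤ t) : |x.pos t 0 - x.pos s 0| ≤ t - s := by
  refine (abs_le_of_sq_le_sq' ?_ (sub_nonneg.2 hst)).2
  rw [sq_abs]
  linarith [x.dist_sq_le hst, sq_nonneg (x.pos t 1 - x.pos s 1)]

theorem le_two_sqrt_two_mul {a : ℝ} (ha : 0 ≤ a) : a ≤ 2 * Real.sqrt 2 * a := by
  have : 1 ≤ Real.sqrt 2 := Real.one_le_sqrt.2 (by norm_num)
  nlinarith

/-- The word of a trajectory segment that starts by entering a strip. Every passage takes at
least one unit of time, which makes the induction over the passages possible. -/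
theorem hasWord_cellClass_of_enters (N : ℕ) : ∀ {s t : ℝ} {l m : ℤ} (_ : s ≤ t) (_ : t - s ≤ N)
    (hs : x.Enters s l) (ht : x.point t ∈ B.strip m),
    HasWord (x.cellClass s t hs.mem_strip ht) (2 * Real.sqrt 2 * (t - s) + 2) := by
  induction N with
  | zero =>
    intro s t l m hst hN hs ht
    obtain rfl : s = t := by push_cast at hN; linarith
    exact (x.hasWord_cellClass_self _ _).mono (by linarith [sub_self s])
  | succ N ih =>
    intro s t l m hst hN hs ht
    obtain ⟨u, hu, hstrip, hcase⟩ := x.exists_exit l hst hs.mem_strip.1 hs.mem_strip.2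
    rcases hcase with rfl | hleave
    · refine (x.hasWord_cellClass_of_exit hst hstrip _ ht ht
        (x.hasWord_cellClass_refl _)).mono ?_
      linarith [x.abs_sub_le hst, le_two_sqrt_two_mul (sub_nonneg.2 hst)]
    · obtain ⟨l', hl'⟩ := Leaves.exists_enters (x := x) hleave
      obtain ⟨h1, h2⟩ := x.passage_letters hu.1 hs hleave
      push_cast at hN
      refine (x.hasWord_cellClass_of_exit hu.1 hstrip _ hl'.mem_strip ht
        (ih hu.2 (by linarith) hl' ht)).mono ?_
      linarith

/-- Before the first passage and after the last one there are at most `|Δx| + 2` letters each,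
which accounts for the additive constant. -/
theorem hasWord_homotopyClass {T : ℝ} (hT : 0 ≤ T) :
    HasWord (x.homotopyClass T) (2 * Real.sqrt 2 * T + 4) := by
  rw [homotopyClass_eq_cellClass]
  obtain ⟨u, hu, hstrip, hcase⟩ := x.exists_exit ⌊x.pos 0 1⌋ hT (Int.floor_le _)
    (Int.lt_floor_add_one _).le
  have hdx := x.abs_sub_le hu.1
  have hle := le_two_sqrt_two_mul (sub_nonneg.2 hu.1)
  rcases hcase with rfl | hleave
  · refine (x.hasWord_cellClass_of_exit hT hstrip _ _ _
      (x.hasWord_cellClass_refl _)).mono ?_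
    linarith
  · obtain ⟨l', hl'⟩ := Leaves.exists_enters (x := x) hleave
    obtain ⟨N, hN⟩ := exists_nat_ge (T - u)
    refine (x.hasWord_cellClass_of_exit hu.1 hstrip _ hl'.mem_strip _
      (x.hasWord_cellClass_of_enters N hu.2 hN hl' _)).mono ?_
    linarith

end Trajectory

/-! ### Distances in the Cayley graph -/

theorem edist_mul_generator_le (g : B.Pi1) (o : Option (Fin B.n)) :
    B.cayleyGraph.edist (g * B.generator o) g ≤ 1 := by
  rw [SimpleGraph.edist_le_one_iff_adj_or_eq, cayleyGraph, SimpleGraph.mulCayley_adj']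
  by_cases h : g * B.generator o = g
  · exact Or.inr h
  · exact Or.inl ⟨h, B.generator o, ⟨o, rfl⟩, Or.inr rfl⟩

theorem edist_mul_evalWord_le (L : List (Option (Fin B.n) × Bool)) :
    ∀ g : B.Pi1, B.cayleyGraph.edist (g * B.evalWord (FreeGroup.mk L)) g ≤ L.length := by
  induction L with
  | nil => intro g; simp [← FreeGroup.one_eq_mk]
  | cons c L ih =>
    intro g
    have hc : B.cayleyGraph.edist (g * B.evalWord (FreeGroup.mk [c])) g ≤ 1 := by
      obtain ⟨o, b⟩ := c
      cases b
      · have := edist_mul_generator_le (g * (B.generator o)⁻¹) o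
        rw [inv_mul_cancel_right, SimpleGraph.edist_comm] at this
        simpa [evalWord] using this
      · simpa [evalWord] using edist_mul_generator_le g o
    have hsplit : FreeGroup.mk (c :: L) = FreeGroup.mk [c] * FreeGroup.mk L := by simp
    rw [hsplit, map_mul, ← mul_assoc]
    refine SimpleGraph.edist_triangle.trans ((add_le_add (ih _) hc).trans ?_)
    simp

theorem dist_le_norm (w : FreeGroup (Option (Fin B.n))) :
    B.cayleyGraph.dist (B.evalWord w) 1 ≤ w.norm := by
  have h := edist_mul_evalWord_le w.toWord (1 : B.Pi1)
  rw [one_mul, FreeGroup.mk_toWord] at h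
  exact ENat.toNat_le_of_le_natCast h

end BilliardTable

end

theorem theorem2p1 :
    (∀ B : BilliardTable, B.rotationSet ⊆ InfiniteCone.ball (2 * Real.sqrt 2)) ∧
    (∃ C : ℝ, ∀ (B : BilliardTable) (x : B.Trajectory) (T : ℝ), 0 ≤ T →
      ∃ w : FreeGroup (Option (Fin B.n)), B.evalWord w = x.homotopyClass T ∧
        (w.norm : ℝ) ≤ 2 * Real.sqrt 2 * T + C) := by
  refine ⟨?_, 4, fun B x T hT => x.hasWord_homotopyClass hT⟩
  rintro B c ⟨s, e, rfl, x, T, hT, hlim, -⟩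
  change (s : ℝ) ≤ 2 * Real.sqrt 2
  have hbound : Tendsto (fun j => 2 * Real.sqrt 2 + 4 / T j) atTop (𝓝 (2 * Real.sqrt 2 + 0)) :=
    tendsto_const_nhds.add (tendsto_const_nhds.div_atTop hT)
  rw [add_zero] at hbound
  refine le_of_tendsto_of_tendsto hlim hbound ?_
  filter_upwards [hT.eventually_gt_atTop 0] with j hj
  obtain ⟨w, hw, hn⟩ := (x j).hasWord_homotopyClass hj.le
  have hd : (B.cayleyGraph.dist ((x j).homotopyClass (T j)) 1 : ℝ) ≤ w.norm := by
    rw [← hw]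
    exact_mod_cast BilliardTable.dist_le_norm w
  rw [div_le_iff₀ hj, add_mul, div_mul_cancel₀ _ hj.ne']
  linarith
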